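/- Let $N\in\{2,3\}$, let $\Omega\subset\mathbb{R}^N$ be a (bounded) convex polygonal/polyhedral domain, and let $T,\alpha,\beta,\delta,r>0$. Let $I=(0,T)$, write $(\cdot,\cdot)$ and $\|\cdot\|$ for the inner product and norm of $L^2(\Omega)$, and $(\cdot,\cdot)_{I\times\Omega}$ and $\|\cdot\|_{I\times\Omega}$ for those of $L^2(0,T;L^2(\Omega))$. For a partition $0=t_0<t_1<\dots<t_M=T$ put $I_m=(t_{m-1},t_m]$, $\tau_m=t_m-t_{m-1}$ and $\tau=\max_{1\le m\le M}\tau_m$. Let $V^0_\tau$ and $X^0_\tau$ be the spaces of functions that are constant in time on every $I_m$, with values in $H^1_0(\Omega)$ and in $L^2(\Omega)$, respectively. For such functions write $v_m=v(t_m)$ ($1\le m\le M$), $v^+_m=v_{m+1}$ ($0\le m<M$), $[v]_m=v_{m+1}-v_m$ ($1\le m<M$). Given $l\in L^2(0,T;L^2(\Omega))$ and $d_0\in L^2(\Omega)$, the pair $(\varphi_\tau,d_\tau)\in V^0_\tau\times X^0_\tau$ is a solution of the dG(0) semidiscrete state equation if for all $(\psi,\lambda)\in V^0_\tau\times X^0_\tau$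 $$\alpha(\nabla\varphi_\tau,\nabla\psi)_{I\times\Omega}+\beta(\varphi_\tau,\psi)_{I\times\Omega}-\beta(d_\tau,\psi)_{I\times\Omega}+\sum_{m=1}^M\int_{I_m}(\partial_t d_\tau,\lambda)\,dt+\sum_{m=2}^M([d_\tau]_{m-1},\lambda^+_{m-1})+(d^+_{\tau,0},\lambda^+_0)$$ $$=(l,\psi)_{I\times\Omega}+\tfrac1\delta\big(\max\{-\beta(d_\tau-\varphi_\tau)-r,0\},\lambda\big)_{I\times\Omega}+(d_0,\lambda^+_0).$$ Theorem. There are constants $C>0$ and $\tau_*>0$, depending only on $\Omega,N,T,\alpha,\beta,\delta,r$, such that for every partition with $\tau\le\tau_*$, all $l\in L^2(0,T;L^2(\Omega))$ and $d_0\in L^2(\Omega)$, and every solution $(\varphi_\tau,d_\tau)$ of the semidiscrete state equation, the weak Laplacian $\Delta\varphi_\tau$ (the weak divergence of $\nabla\varphi_\tau$) exists as a function with values in $L^2(\Omega)$ that is constant on every $I_m$, and $$\|\Delta\varphi_\tau\|^2_{I\times\Omega}+\|\nabla\varphi_\tau\|^2_{I\times\Omega}+\|\varphi_\tau\|^2_{I\times\Omega}+\|d_\tau\|^2_{I\times\Omega}+\sum_{m=1}^M\tau_m^{-1}\|[d_\tau]_{m-1}\|^2\le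 C\big\{\|d_0\|^2+\|l\|^2_{I\times\Omega}\big\},$$ where $[d_\tau]_0:=d_{\tau,1}-d_0$. In particular $C$ is independent of the partition, of $l$ and of $d_0$. -/

import Mathlib

open MeasureTheory Set
open scoped ContDiff InnerProductSpace ENNReal

noncomputable section

namespace SemidiscreteDamage

/-- The Euclidean space `ℝ^N`. -/
abbrev Space (N : ℕ) := EuclideanSpace ℝ (Fin N)

/-- A (bounded) convex polygonal or polyhedral domain: the nonempty interior of the convex hull of
finitely many points. -/
def IsConvexPolygonalDomain {N : ℕ} (Ω : Set (Space N)) : Prop :=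
  Ω.Nonempty ∧ ∃ F : Set (Space N), F.Finite ∧ Ω = interior (convexHull ℝ F)

/-- `L²(Ω)`. -/
abbrev L2 {N : ℕ} (Ω : Set (Space N)) := Lp ℝ 2 (volume.restrict Ω)

/-- `L²(Ω; ℝ^N)`. -/
abbrev L2Vec {N : ℕ} (Ω : Set (Space N)) := Lp (Space N) 2 (volume.restrict Ω)

/-- `L²(0, T; L²(Ω))`. -/
abbrev L2L2 {N : ℕ} (T : ℝ) (Ω : Set (Space N)) := Lp (L2 Ω) 2 (volume.restrict (Ioo 0 T))

/-- Membership in `C_c^∞(Ω)`. -/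
structure IsTestFunction {N : ℕ} (Ω : Set (Space N)) (η : Space N → ℝ) : Prop where
  smooth : ContDiff ℝ ∞ η
  compact : HasCompactSupport η
  supp : tsupport η ⊆ Ω

/-- The space of all pairs `(η, ∇η)`, `η ∈ C_c^∞(Ω)`, in `L²(Ω) × L²(Ω; ℝ^N)`; the norm of this
Hilbert space restricts to the `H¹(Ω)`-norm on these pairs. -/
def testPairs {N : ℕ} (Ω : Set (Space N)) : Submodule ℝ (WithLp 2 (L2 Ω × L2Vec Ω)) where
  carrier := {p | ∃ η : Space N → ℝ, IsTestFunction Ω η ∧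
    p.fst =ᵐ[volume.restrict Ω] η ∧ p.snd =ᵐ[volume.restrict Ω] gradient η}
  zero_mem' := by
    refine ⟨0, ⟨contDiff_const, HasCompactSupport.zero, by simp⟩, Lp.coeFn_zero _ _ _, ?_⟩
    have h : gradient (0 : Space N → ℝ) = 0 := by
      funext x; exact gradient_const x (0 : ℝ)
    rw [h]
    exact Lp.coeFn_zero _ _ _
  add_mem' := by
    rintro p q ⟨η, hη, hp1, hp2⟩ ⟨ζ, hζ, hq1, hq2⟩
    refine ⟨η + ζ, ⟨hη.smooth.add hζ.smooth, hη.compact.add hζ.compact, ?_⟩, ?_, ?_⟩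
    · exact (tsupport_add η ζ).trans (union_subset hη.supp hζ.supp)
    · exact (Lp.coeFn_add _ _).trans (hp1.add hq1)
    · have h : gradient (η + ζ) = gradient η + gradient ζ := by
        funext x
        simp only [gradient, Pi.add_apply]
        rw [fderiv_add (hη.smooth.differentiable (by simp) x)
          (hζ.smooth.differentiable (by simp) x), map_add]
      rw [h]
      exact (Lp.coeFn_add _ _).trans (hp2.add hq2)
  smul_mem' := by
    rintro c p ⟨η, hη, hp1, hp2⟩
    refine ⟨c • η, ⟨hη.smooth.const_smul c, hη.compact.smul_left, ?_⟩, ?_, ?_⟩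
    · exact (closure_mono (Function.support_const_smul_subset c η)).trans hη.supp
    · exact (Lp.coeFn_smul _ _).trans (hp1.const_smul c)
    · have h : gradient (c • η) = c • gradient η := by
        funext x
        simp only [gradient, Pi.smul_apply]
        rw [fderiv_const_smul (hη.smooth.differentiable (by simp) x), map_smul]
      rw [h]
      exact (Lp.coeFn_smul _ _).trans (hp2.const_smul c)

/-- `H¹₀(Ω)`, the closure of `C_c^∞(Ω)` in the `H¹(Ω)`-norm. An element is stored as the pair of a
function and its weak gradient. -/
abbrev H10 {N : ℕ} (Ω : Set (Space N)) := (testPairs Ω).topologicalClosure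

/-- The function in `L²(Ω)` underlying an element of `H¹₀(Ω)`. -/
def toL2 {N : ℕ} {Ω : Set (Space N)} (v : H10 Ω) : L2 Ω := (v : WithLp 2 (L2 Ω × L2Vec Ω)).fst

/-- The weak gradient of an element of `H¹₀(Ω)`. -/
def weakGrad {N : ℕ} {Ω : Set (Space N)} (v : H10 Ω) : L2Vec Ω :=
  (v : WithLp 2 (L2 Ω × L2Vec Ω)).snd

/-- `g ∈ L²(Ω)` is the weak Laplacian of `v`, that is, the weak divergence of `∇v`. -/
def HasWeakLaplacian {N : ℕ} {Ω : Set (Space N)} (v : H10 Ω) (g : L2 Ω) : Prop :=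
  ∀ η : Space N → ℝ, IsTestFunction Ω η →
    ∫ x in Ω, ⟪weakGrad v x, gradient η x⟫_ℝ = - ∫ x in Ω, g x * η x

/-- A partition `0 = t₀ < t₁ < … < t_M = T` of the time interval (values of `node` beyond `M` are
irrelevant). -/
structure TimePartition (T : ℝ) where
  /-- the number of subintervals -/
  M : ℕ
  /-- the time points -/
  node : ℕ → ℝ
  node_zero : node 0 = 0
  node_last : node M = T
  node_lt : ∀ m < M, node m < node (m + 1)

namespace TimePartition

variable {T : ℝ} (P : TimePartition T)

/-- `τ_m = t_m - t_{m-1}`, for `1 ≤ m ≤ M`. -/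
def step (m : ℕ) : ℝ := P.node m - P.node (m - 1)

/-- `τ = max {τ_m : 1 ≤ m ≤ M}`. -/
def mesh : ℝ := sSup (P.step '' Icc 1 P.M)

/-- `I_m = (t_{m-1}, t_m]`, for `1 ≤ m ≤ M`. -/
def interval (m : ℕ) : Set ℝ := Ioc (P.node (m - 1)) (P.node m)

/-- `v` is constant on each subinterval `I_m`. For `E = H¹₀(Ω)` and `E = L²(Ω)` this describes the
dG(0) spaces `V⁰_τ` and `X⁰_τ`; only the values of `v` on `(0, T]` matter. -/
def IsPiecewiseConst {E : Type*} (v : ℝ → E) : Prop :=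
  ∀ m ∈ Icc 1 P.M, ∀ t ∈ P.interval m, v t = v (P.node m)

/-- `v_m⁺`, the right limit of `v` at `t_m`, which for `v` constant on `I_{m+1}` is the value
`v_{m+1} = v(t_{m+1})`, for `0 ≤ m < M`. -/
def plus {E : Type*} (v : ℝ → E) (m : ℕ) : E := v (P.node (m + 1))

/-- `v_m⁻`, the left limit of `v` at `t_m`, which for `v` constant on `I_m` is the value
`v_m = v(t_m)`, for `1 ≤ m ≤ M`. -/
def minus {E : Type*} (v : ℝ → E) (m : ℕ) : E := v (P.node m)

/-- The jump `[v]_m = v_m⁺ - v_m⁻` at an inner node, `1 ≤ m < M`. -/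
def jump {E : Type*} [AddGroup E] (v : ℝ → E) (m : ℕ) : E := P.plus v m - P.minus v m

/-- The jump `[v]_m` for `0 ≤ m < M`, where the value of `v` before the first interval is the
initial state `v₀`: `[v]_0 = v_0⁺ - v₀`. -/
def jumpFrom {E : Type*} [AddGroup E] (v₀ : E) (v : ℝ → E) (m : ℕ) : E :=
  if m = 0 then P.plus v 0 - v₀ else P.jump v m

end TimePartition

/-- The semidiscrete form `𝔅((φ, d), (ψ, lam))`. -/
def semidiscreteForm {N : ℕ} {Ω : Set (Space N)} {T : ℝ} (α β : ℝ) (P : TimePartition T)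
    (φ : ℝ → H10 Ω) (d : ℝ → L2 Ω) (ψ : ℝ → H10 Ω) (lam : ℝ → L2 Ω) : ℝ :=
  α * (∫ t in Ioo 0 T, ⟪weakGrad (φ t), weakGrad (ψ t)⟫_ℝ)
    + β * (∫ t in Ioo 0 T, ⟪toL2 (φ t), toL2 (ψ t)⟫_ℝ)
    - β * (∫ t in Ioo 0 T, ⟪d t, toL2 (ψ t)⟫_ℝ)
    + ∑ m ∈ Finset.Icc 1 P.M,
        (∫ t in Ioo (P.node (m - 1)) (P.node m), ⟪deriv d t, lam t⟫_ℝ)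
    + ∑ m ∈ Finset.Icc 2 P.M, ⟪P.jump d (m - 1), P.plus lam (m - 1)⟫_ℝ
    + ⟪P.plus d 0, P.plus lam 0⟫_ℝ

/-- `(φ, d) ∈ V⁰_τ × X⁰_τ` solves the semidiscrete state equation with right-hand side `l` and
initial state `d₀`. -/
structure IsSemidiscreteSolution {N : ℕ} {Ω : Set (Space N)} {T : ℝ} (α β δ r : ℝ)
    (P : TimePartition T) (l : L2L2 T Ω) (d₀ : L2 Ω)
    (φ : ℝ → H10 Ω) (d : ℝ → L2 Ω) : Prop where
  mem_V : P.IsPiecewiseConst φ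
  mem_X : P.IsPiecewiseConst d
  eqn : ∀ (ψ : ℝ → H10 Ω) (lam : ℝ → L2 Ω), P.IsPiecewiseConst ψ → P.IsPiecewiseConst lam →
    semidiscreteForm α β P φ d ψ lam =
      (∫ t in Ioo 0 T, ⟪l t, toL2 (ψ t)⟫_ℝ)
        + 1 / δ * (∫ t in Ioo 0 T, ∫ x in Ω,
            max (-β * (d t x - toL2 (φ t) x) - r) 0 * lam t x)
        + ⟪d₀, P.plus lam 0⟫_ℝ

/-- `‖v‖²` in `L²(0, T; E)`, for `v` piecewise constant in time. -/
def normSqTime {E : Type*} [NormedAddCommGroup E] (T : ℝ) (v : ℝ → E) : ℝ :=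
  ∫ t in Ioo 0 T, ‖v t‖ ^ 2

end SemidiscreteDamage

end

/-! Test functions supported on a single $I_m$ decouple the scheme: on $I_m$ it is the elliptic
equation $-\alpha\Delta\varphi_m+\beta\varphi_m=\beta d_m+l_m$, with $l_m$ the time mean of $l$,
together with the implicit Euler step
$d_m-d_{m-1}=\frac{\tau_m}{\delta}\max\{-\beta(d_m-\varphi_m)-r,0\}$ (`elliptic`, `inner_jump`).

Testing the elliptic equation with $\varphi_m$ bounds $\varphi_m$ and $\nabla\varphi_m$ by $d_m$ and
$l_m$; solving it for $\Delta\varphi_m$ gives the Laplacian and its bound. Since $r\ge 0$, the max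
is at most $\beta|d_m-\varphi_m|$ pointwise, so testing the Euler step with the jump itself yields
$\|d_m-d_{m-1}\|\le\tau_m K(\|d_m\|+\|l_m\|)$ with $K=(2\beta+1)/\delta$ (`norm_jump_le`).

For $K\tau\le\frac12$ the discrete Gronwall inequality then bounds every $\|d_m\|$ by the data
(`norm_sq_le`). All terms of the estimate are controlled on $I_m$ by $\tau_m(\|d_m\|^2+\|l_m\|^2)$
(`local_bound`); summing over $m$ finishes the proof. -/

namespace SemidiscreteDamage

/-! ### Partitions, piecewise constant functions and discrete Gronwall -/

namespace TimePartition

variable {T : ℝ} (P : TimePartition T)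

lemma node_mono {i j : ℕ} (hij : i ≤ j) (hj : j ≤ P.M) : P.node i ≤ P.node j := by
  induction j, hij using Nat.le_induction with
  | base => exact le_rfl
  | succ k _ ih => exact (ih (by omega)).trans (P.node_lt k (by omega)).le

lemma node_nonneg {m : ℕ} (hm : m ≤ P.M) : 0 ≤ P.node m :=
  P.node_zero ▸ P.node_mono (Nat.zero_le m) hm

lemma node_le {m : ℕ} (hm : m ≤ P.M) : P.node m ≤ T := by
  have := P.node_mono hm le_rfl
  rwa [P.node_last] at this

lemma node_pred_lt {m : ℕ} (hm : m ∈ Icc 1 P.M) : P.node (m - 1) < P.node m := by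
  obtain ⟨k, rfl⟩ : ∃ k, m = k + 1 := ⟨m - 1, by have := hm.1; omega⟩
  exact P.node_lt k hm.2

lemma step_pos {m : ℕ} (hm : m ∈ Icc 1 P.M) : 0 < P.step m :=
  sub_pos.2 (P.node_pred_lt hm)

lemma step_le_mesh {m : ℕ} (hm : m ∈ Icc 1 P.M) : P.step m ≤ P.mesh :=
  le_csSup ((Set.finite_Icc 1 P.M).image _).bddAbove (mem_image_of_mem _ hm)

lemma node_mem_interval {m : ℕ} (hm : m ∈ Icc 1 P.M) : P.node m ∈ P.interval m :=
  ⟨P.node_pred_lt hm, le_rfl⟩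

lemma interval_subset {m : ℕ} (hm : m ∈ Icc 1 P.M) : P.interval m ⊆ Ioc 0 T :=
  Ioc_subset_Ioc (P.node_nonneg ((Nat.sub_le m 1).trans hm.2)) (P.node_le hm.2)

lemma interval_injective {i j : ℕ} (hi : i ∈ Icc 1 P.M) (hj : j ∈ Icc 1 P.M) {t : ℝ}
    (hti : t ∈ P.interval i) (htj : t ∈ P.interval j) : i = j := by
  by_contra hne
  have key : ∀ {i j : ℕ}, i ∈ Icc 1 P.M → j ∈ Icc 1 P.M → t ∈ P.interval i → t ∈ P.interval j →
      ¬ i < j := by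
    intro i j _ hj hti htj hij
    have h := P.node_mono (i := i) (j := j - 1) (by omega) ((Nat.sub_le j 1).trans hj.2)
    exact absurd (hti.2.trans h) (not_le.2 htj.1)
  rcases lt_or_gt_of_ne hne with h | h
  · exact key hi hj hti htj h
  · exact key hj hi htj hti h

lemma exists_mem_interval {t : ℝ} (ht : t ∈ Ioc 0 T) : ∃ m ∈ Icc 1 P.M, t ∈ P.interval m := by
  classical
  have hex : ∃ m, m ≤ P.M ∧ t ≤ P.node m := ⟨P.M, le_rfl, ht.2.trans P.node_last.ge⟩
  obtain ⟨hle, hnode⟩ := Nat.find_spec hex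
  have h0 : Nat.find hex ≠ 0 := by
    intro h
    rw [h, P.node_zero] at hnode
    exact absurd ht.1 (not_lt.2 hnode)
  refine ⟨Nat.find hex, ⟨Nat.one_le_iff_ne_zero.2 h0, hle⟩, ?_, hnode⟩
  by_contra hlt
  exact Nat.find_min hex (Nat.sub_one_lt h0) ⟨(Nat.sub_le _ 1).trans hle, not_lt.1 hlt⟩

lemma sum_step : ∑ m ∈ Finset.Icc 1 P.M, P.step m = T := by
  have h : ∑ m ∈ Finset.range P.M, (P.node (m + 1) - P.node m) = T := by
    rw [Finset.sum_range_sub, P.node_zero, P.node_last, sub_zero]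
  refine Eq.trans ?_ h
  rw [Finset.range_eq_Ico]
  exact (Finset.sum_Ico_add' (fun m => P.node m - P.node (m - 1)) 0 P.M 1).symm

lemma setIntegral_eq_sum {f : ℝ → ℝ} (hf : IntegrableOn f (Ioo 0 T)) :
    ∫ t in Ioo 0 T, f t = ∑ m ∈ Finset.Icc 1 P.M, ∫ t in P.interval m, f t := by
  have hU : Ioc 0 T = ⋃ m ∈ Finset.Icc 1 P.M, P.interval m := by
    ext t
    simp only [mem_iUnion, Finset.mem_Icc, exists_prop]
    exact ⟨fun ht => P.exists_mem_interval ht, fun ⟨m, hm, ht⟩ => P.interval_subset hm ht⟩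
  rw [← integral_Ioc_eq_integral_Ioo, hU, integral_biUnion_finset]
  · exact fun m _ => measurableSet_Ioc
  · intro i hi j hj hij
    refine disjoint_left.2 fun t hti htj => hij ?_
    exact P.interval_injective (by simpa using hi) (by simpa using hj) hti htj
  · intro m hm
    rw [← integrableOn_Ioc_iff_integrableOn_Ioo] at hf
    exact hf.mono_set (P.interval_subset (by simpa using hm))

lemma setIntegral_interval_const {m : ℕ} (hm : m ∈ Icc 1 P.M) {f : ℝ → ℝ} {c : ℝ}
    (hf : ∀ t ∈ P.interval m, f t = c) : ∫ t in P.interval m, f t = P.step m * c := by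
  rw [interval, setIntegral_congr_fun measurableSet_Ioc hf, setIntegral_const]
  simp [step, (P.node_pred_lt hm).le]

lemma IsPiecewiseConst.setIntegral {f : ℝ → ℝ} (hf : P.IsPiecewiseConst f) :
    ∫ t in Ioo 0 T, f t = ∑ m ∈ Finset.Icc 1 P.M, P.step m * f (P.node m) := by
  rw [P.setIntegral_eq_sum]
  · refine Finset.sum_congr rfl fun m hm => ?_
    exact P.setIntegral_interval_const (by simpa using hm) (hf m (by simpa using hm))
  · rw [← integrableOn_Ioc_iff_integrableOn_Ioo]
    have hU : Ioc 0 T ⊆ ⋃ m ∈ Finset.Icc 1 P.M, P.interval m := fun t ht => by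
      simpa using P.exists_mem_interval ht
    refine IntegrableOn.mono_set ?_ hU
    refine (integrableOn_finset_iUnion (s := Finset.Icc 1 P.M)).2 fun m hm => ?_
    refine (integrableOn_congr_fun (hf m (by simpa using hm)) measurableSet_Ioc).2 ?_
    exact integrableOn_const (by simp [interval])

lemma setIntegral_eq_interval {m : ℕ} (hm : m ∈ Icc 1 P.M) {f : ℝ → ℝ}
    (hf : ∀ t ∉ P.interval m, f t = 0) :
    ∫ t in Ioo 0 T, f t = ∫ t in P.interval m, f t := by
  rw [← integral_Ioc_eq_integral_Ioo]
  exact setIntegral_eq_of_subset_of_forall_sdiff_eq_zero measurableSet_Ioc (P.interval_subset hm)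
    fun t ht => hf t ht.2

/-- The function which is `v` on `I_m` and vanishes elsewhere. -/
noncomputable def bump {E : Type*} [Zero E] (m : ℕ) (v : E) : ℝ → E := (P.interval m).indicator fun _ => v

lemma bump_of_mem {E : Type*} [Zero E] {m : ℕ} (v : E) {t : ℝ} (ht : t ∈ P.interval m) :
    P.bump m v t = v := indicator_of_mem ht _

lemma bump_of_notMem {E : Type*} [Zero E] {m : ℕ} (v : E) {t : ℝ} (ht : t ∉ P.interval m) :
    P.bump m v t = 0 := indicator_of_notMem ht _

lemma bump_node {E : Type*} [Zero E] {m j : ℕ} (hm : m ∈ Icc 1 P.M) (hj : j ∈ Icc 1 P.M) (v : E) :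
    P.bump m v (P.node j) = if j = m then v else 0 := by
  split_ifs with h
  · exact P.bump_of_mem v (h ▸ P.node_mem_interval hj)
  · exact P.bump_of_notMem v fun h' => h (P.interval_injective hj hm (P.node_mem_interval hj) h')

lemma bump_isPiecewiseConst {E : Type*} [Zero E] {m : ℕ} (hm : m ∈ Icc 1 P.M) (v : E) :
    P.IsPiecewiseConst (P.bump m v) := by
  intro j hj t ht
  rw [P.bump_node hm hj]
  split_ifs with h
  · exact P.bump_of_mem v (h ▸ ht)
  · exact P.bump_of_notMem v fun h' => h (P.interval_injective hj hm ht h')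

lemma zero_isPiecewiseConst {E : Type*} [Zero E] : P.IsPiecewiseConst (0 : ℝ → E) :=
  fun _ _ _ _ => rfl

/-- The function which is `g m` on `I_m`. -/
noncomputable def stepFun {E : Type*} [AddCommMonoid E] (g : ℕ → E) (t : ℝ) : E :=
  ∑ m ∈ Finset.Icc 1 P.M, P.bump m (g m) t

lemma stepFun_of_mem {E : Type*} [AddCommMonoid E] (g : ℕ → E) {m : ℕ} (hm : m ∈ Icc 1 P.M)
    {t : ℝ} (ht : t ∈ P.interval m) : P.stepFun g t = g m := by
  rw [stepFun, Finset.sum_eq_single_of_mem m (by simpa using hm), P.bump_of_mem _ ht]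
  intro j hj hne
  exact P.bump_of_notMem _ fun h => hne (P.interval_injective (by simpa using hj) hm h ht)

lemma stepFun_isPiecewiseConst {E : Type*} [AddCommMonoid E] (g : ℕ → E) :
    P.IsPiecewiseConst (P.stepFun g) := fun m hm t ht => by
  rw [P.stepFun_of_mem g hm ht, P.stepFun_of_mem g hm (P.node_mem_interval hm)]

lemma IsPiecewiseConst.normSqTime {E : Type*} [NormedAddCommGroup E] {v : ℝ → E}
    (hv : P.IsPiecewiseConst v) :
    normSqTime T v = ∑ m ∈ Finset.Icc 1 P.M, P.step m * ‖v (P.node m)‖ ^ 2 :=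
  IsPiecewiseConst.setIntegral P (f := fun t => ‖v t‖ ^ 2)
    fun m hm t ht => by simp only [hv m hm t ht]

lemma IsPiecewiseConst.deriv_eq_zero {E : Type*} [NormedAddCommGroup E] [NormedSpace ℝ E]
    {v : ℝ → E} (hv : P.IsPiecewiseConst v) {m : ℕ} (hm : m ∈ Icc 1 P.M) {t : ℝ}
    (ht : t ∈ Ioo (P.node (m - 1)) (P.node m)) : deriv v t = 0 := by
  have h : v =ᶠ[nhds t] fun _ => v (P.node m) :=
    Filter.eventually_of_mem (Ioo_mem_nhds ht.1 ht.2) fun s hs => hv m hm s ⟨hs.1, hs.2.le⟩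
  rw [h.deriv_eq, deriv_const]

/-- The values `d_m` for `1 ≤ m ≤ M`, preceded by the initial state. -/
noncomputable def state {E : Type*} (v₀ : E) (v : ℝ → E) (m : ℕ) : E := if m = 0 then v₀ else v (P.node m)

lemma state_of_mem {E : Type*} (v₀ : E) (v : ℝ → E) {m : ℕ} (hm : m ∈ Icc 1 P.M) :
    P.state v₀ v m = v (P.node m) := if_neg (Nat.one_le_iff_ne_zero.1 hm.1)

/-- Placing the initial state at index 0 makes initial and inner jumps differences of one sequence,
so that a single recursion covers every $m$. -/
lemma jumpFrom_pred {E : Type*} [AddGroup E] (v₀ : E) (v : ℝ → E) {m : ℕ} (hm : 1 ≤ m) :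
    P.jumpFrom v₀ v (m - 1) = P.state v₀ v m - P.state v₀ v (m - 1) := by
  obtain ⟨k, rfl⟩ : ∃ k, m = k + 1 := ⟨m - 1, by omega⟩
  rcases Nat.eq_zero_or_pos k with rfl | hk
  · simp [jumpFrom, state, plus]
  · simp [jumpFrom, state, jump, plus, minus, hk.ne']

/-- A discrete Gronwall inequality. -/
lemma gronwall {K : ℝ} (hK : 0 ≤ K) (hmesh : ∀ m ∈ Icc 1 P.M, K * P.step m ≤ 1 / 2) {a b : ℕ → ℝ}
    (ha : ∀ m, 0 ≤ a m) (hb : ∀ m, 0 ≤ b m)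
    (hrec : ∀ m ∈ Icc 1 P.M, a m ≤ a (m - 1) + P.step m * (K * (a m + b m))) {m : ℕ}
    (hm : m ≤ P.M) :
    a m ≤ Real.exp (2 * K * P.node m)
      * (a 0 + K * ∑ j ∈ Finset.Icc 1 m, P.step j * b j) := by
  induction m with
  | zero => simp [P.node_zero]
  | succ k ih =>
    have hk : k + 1 ∈ Icc 1 P.M := ⟨by omega, hm⟩
    have h1 := hrec _ hk
    have hs := P.step_pos hk
    have hq := hmesh _ hk
    rw [Nat.add_sub_cancel] at h1
    rw [Finset.sum_Icc_succ_top (by omega)]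
    set s := P.step (k + 1) with hsdef
    set S := ∑ j ∈ Finset.Icc 1 k, P.step j * b j
    have hnode : P.node (k + 1) = P.node k + s := by simp [hsdef, step]
    have hb' := hb (k + 1)
    have hc : 0 ≤ K * (s * b (k + 1)) := by positivity
    have hx : 0 ≤ K * s := by positivity
    have ha1 := ha (k + 1)
    have h2 : a (k + 1) ≤ (1 + 2 * (K * s)) * (a k + K * (s * b (k + 1))) := by
      have h3 : (1 - K * s) * a (k + 1) ≤ a k + K * (s * b (k + 1)) := by linarith
      -- The implicit term is absorbed through $(1-x)^{-1}\le 1+2x$ on $[0,\frac12]$, which is where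
      -- the mesh restriction enters.
      have h4 : 1 ≤ (1 + 2 * (K * s)) * (1 - K * s) := by nlinarith
      calc a (k + 1) ≤ ((1 + 2 * (K * s)) * (1 - K * s)) * a (k + 1) :=
            le_mul_of_one_le_left ha1 h4
        _ = (1 + 2 * (K * s)) * ((1 - K * s) * a (k + 1)) := by ring
        _ ≤ _ := by gcongr
    have hexp : 1 + 2 * (K * s) ≤ Real.exp (2 * K * s) := by
      have := Real.add_one_le_exp (2 * K * s)
      linarith
    -- Enlarging the new forcing term by this factor lets it share the exponential of the induction
    -- hypothesis.
    have hone : 1 ≤ Real.exp (2 * K * P.node k) := by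
      have h := P.node_nonneg (m := k) (by omega)
      exact Real.one_le_exp (by positivity)
    have hak := ih (by omega)
    calc a (k + 1) ≤ (1 + 2 * (K * s)) * (a k + K * (s * b (k + 1))) := h2
      _ ≤ Real.exp (2 * K * s) * (Real.exp (2 * K * P.node k) * (a 0 + K * S)
            + Real.exp (2 * K * P.node k) * (K * (s * b (k + 1)))) := by
          have hle := add_le_add hak (le_mul_of_one_le_left hc hone)
          exact mul_le_mul hexp hle (add_nonneg (ha k) hc) (Real.exp_pos _).le
      _ = Real.exp (2 * K * P.node (k + 1)) * (a 0 + K * (S + s * b (k + 1))) := by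
          rw [hnode, mul_add (2 * K), Real.exp_add]
          ring

end TimePartition
variable {N : ℕ} {Ω : Set (Space N)} {T α β δ r : ℝ} {P : TimePartition T} {l : L2L2 T Ω}
  {d₀ : L2 Ω} {φ : ℝ → H10 Ω} {d : ℝ → L2 Ω}

/-! ### Test functions and the weak Laplacian -/

lemma toL2_zero : toL2 (0 : H10 Ω) = 0 := rfl

lemma weakGrad_zero : weakGrad (0 : H10 Ω) = 0 := rfl

lemma exists_testFunction_mem_H10 {η : Space N → ℝ} (hη : IsTestFunction Ω η) :
    ∃ v : H10 Ω, toL2 v =ᵐ[volume.restrict Ω] η ∧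
      weakGrad v =ᵐ[volume.restrict Ω] gradient η := by
  have h1 : MemLp η 2 (volume.restrict Ω) :=
    (hη.smooth.continuous.memLp_of_hasCompactSupport hη.compact).restrict Ω
  have hc : Continuous (gradient η) :=
    (InnerProductSpace.toDual ℝ (Space N)).symm.continuous.comp
      (hη.smooth.continuous_fderiv (by simp))
  have hs : HasCompactSupport (gradient η) :=
    (hη.compact.fderiv ℝ).comp_left (map_zero (InnerProductSpace.toDual ℝ (Space N)).symm)
  have h2 : MemLp (gradient η) 2 (volume.restrict Ω) :=
    (hc.memLp_of_hasCompactSupport hs).restrict Ω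
  refine ⟨⟨WithLp.toLp 2 (h1.toLp η, h2.toLp (gradient η)),
    Submodule.le_topologicalClosure _ ⟨η, hη, h1.coeFn_toLp, h2.coeFn_toLp⟩⟩, ?_, ?_⟩
  · exact h1.coeFn_toLp
  · exact h2.coeFn_toLp

lemma hasWeakLaplacian_of_inner_eq {v : H10 Ω} {g : L2 Ω}
    (h : ∀ w : H10 Ω, ⟪weakGrad v, weakGrad w⟫_ℝ = -⟪g, toL2 w⟫_ℝ) : HasWeakLaplacian v g := by
  intro η hη
  obtain ⟨w, hw1, hw2⟩ := exists_testFunction_mem_H10 hη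
  have hw := h w
  rw [L2.inner_def, L2.inner_def] at hw
  have e1 : ∫ x in Ω, ⟪weakGrad v x, gradient η x⟫_ℝ
      = ∫ x in Ω, ⟪weakGrad v x, weakGrad w x⟫_ℝ :=
    integral_congr_ae (hw2.mono fun x hx => by simp only [hx])
  have e2 : ∫ x in Ω, g x * η x = ∫ x in Ω, ⟪g x, toL2 w x⟫_ℝ :=
    integral_congr_ae (hw1.mono fun x hx => by
      simp only [hx, RCLike.inner_apply, conj_trivial]
      simp [mul_comm])
  rw [e1, e2, hw]

/-! ### Time means of the load -/

/-- The mean value of `l` over `I_m`. -/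
noncomputable def timeMean (P : TimePartition T) (l : L2L2 T Ω) (m : ℕ) : L2 Ω :=
  (P.step m)⁻¹ • ∫ t in P.interval m, l t

lemma restrict_interval_le {m : ℕ} (hm : m ∈ Icc 1 P.M) :
    volume.restrict (P.interval m) ≤ volume.restrict (Ioo 0 T) := by
  rw [restrict_Ioo_eq_restrict_Ioc]
  exact Measure.restrict_mono (P.interval_subset hm) le_rfl

lemma integrableOn_interval (l : L2L2 T Ω) {m : ℕ} (hm : m ∈ Icc 1 P.M) :
    IntegrableOn l (P.interval m) :=
  ((Lp.memLp l).integrable one_le_two).mono_measure (restrict_interval_le hm)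

lemma integrable_norm_sq (l : L2L2 T Ω) : IntegrableOn (fun t => ‖l t‖ ^ 2) (Ioo 0 T) :=
  (Lp.memLp l).integrable_norm_pow two_ne_zero

lemma norm_sq_eq_integral (l : L2L2 T Ω) : ‖l‖ ^ 2 = ∫ t in Ioo 0 T, ‖l t‖ ^ 2 := by
  rw [← real_inner_self_eq_norm_sq, L2.inner_def]
  simp only [real_inner_self_eq_norm_sq]

/-- Test functions constant on $I_m$ see the load only through its mean there. -/
lemma integral_inner_eq_timeMean (l : L2L2 T Ω) {m : ℕ} (hm : m ∈ Icc 1 P.M) (x : L2 Ω) :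
    ∫ t in P.interval m, ⟪l t, x⟫_ℝ = P.step m * ⟪timeMean P l m, x⟫_ℝ := by
  have h := integral_inner (𝕜 := ℝ) (integrableOn_interval l hm) x
  simp only [real_inner_comm x]
  rw [h, timeMean, real_inner_smul_right, mul_inv_cancel_left₀ (P.step_pos hm).ne']

/-- Jensen's inequality, obtained by integrating $\|l(t)-c\|^2\ge 0$ with $c$ the mean value. -/
lemma step_mul_norm_timeMean_sq_le (l : L2L2 T Ω) {m : ℕ} (hm : m ∈ Icc 1 P.M) :
    P.step m * ‖timeMean P l m‖ ^ 2 ≤ ∫ t in P.interval m, ‖l t‖ ^ 2 := by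
  set c := timeMean P l m
  have hi1 : IntegrableOn (fun t => ‖l t‖ ^ 2) (P.interval m) :=
    Integrable.mono_measure (integrable_norm_sq l) (restrict_interval_le hm)
  have hi2 : IntegrableOn (fun t => ⟪l t, c⟫_ℝ) (P.interval m) :=
    (integrableOn_interval l hm).inner_const c
  have hi3 : IntegrableOn (fun _ : ℝ => ‖c‖ ^ 2) (P.interval m) :=
    integrableOn_const (by simp [TimePartition.interval])
  have h : ∫ t in P.interval m, (2 * ⟪l t, c⟫_ℝ - ‖c‖ ^ 2) ≤ ∫ t in P.interval m, ‖l t‖ ^ 2 := by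
    refine integral_mono ((hi2.const_mul 2).sub hi3) hi1 fun t => ?_
    have := sq_nonneg ‖l t - c‖
    rw [norm_sub_sq_real] at this
    dsimp only
    linarith
  rw [integral_sub (hi2.const_mul 2) hi3, integral_const_mul, integral_inner_eq_timeMean l hm,
    P.setIntegral_interval_const hm (fun _ _ => rfl), real_inner_self_eq_norm_sq] at h
  linarith

lemma sum_step_mul_norm_timeMean_sq_le (P : TimePartition T) (l : L2L2 T Ω) :
    ∑ m ∈ Finset.Icc 1 P.M, P.step m * ‖timeMean P l m‖ ^ 2 ≤ ‖l‖ ^ 2 := by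
  rw [norm_sq_eq_integral, P.setIntegral_eq_sum (integrable_norm_sq l)]
  exact Finset.sum_le_sum fun m hm => step_mul_norm_timeMean_sq_le l (by simpa using hm)

/-! ### Bounds for the nonlinearity -/

/-- Pointwise domination by an `L²` function bounds the pairing with an `L²` function. -/
lemma integral_mul_le_of_abs_le {f x : L2 Ω} {g : Space N → ℝ}
    (hg : AEStronglyMeasurable g (volume.restrict Ω))
    (hb : ∀ᵐ y ∂volume.restrict Ω, |g y| ≤ |f y|) :
    ∫ y in Ω, g y * x y ≤ ‖f‖ * ‖x‖ := by
  have hmem : MemLp g 2 (volume.restrict Ω) := (Lp.memLp f).of_le hg (by simpa using hb)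
  have hnorm : ‖hmem.toLp g‖ ≤ ‖f‖ := by
    refine Lp.norm_le_norm_of_ae_le ?_
    filter_upwards [hb, hmem.coeFn_toLp] with y hy hy'
    rw [hy']
    exact hy
  have heq : ∫ y in Ω, g y * x y = ⟪hmem.toLp g, x⟫_ℝ := by
    rw [L2.inner_def]
    refine integral_congr_ae (hmem.coeFn_toLp.mono fun y hy => ?_)
    simp only [hy, RCLike.inner_apply, conj_trivial, mul_comm]
  rw [heq]
  exact (real_inner_le_norm _ _).trans (by gcongr)

/-- Because $r\ge 0$, the max is dominated by $|\beta(u-v)|$. The bound is therefore homogeneous in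
$u,v$, and the final estimate has no additive constant. -/
lemma integral_max_mul_le (hβ : 0 ≤ β) (hr : 0 ≤ r) (u v x : L2 Ω) :
    ∫ y in Ω, max (-β * (u y - v y) - r) 0 * x y ≤ β * (‖u‖ + ‖v‖) * ‖x‖ := by
  have hm : AEStronglyMeasurable (fun y => max (-β * (u y - v y) - r) 0) (volume.restrict Ω) := by
    have hu := Lp.aestronglyMeasurable u
    have hv := Lp.aestronglyMeasurable v
    exact (((hu.sub hv).const_mul (-β)).sub aestronglyMeasurable_const).sup
      aestronglyMeasurable_const
  have h := integral_mul_le_of_abs_le (f := β • (u - v)) (x := x) hm (by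
    filter_upwards [Lp.coeFn_smul β (u - v), Lp.coeFn_sub u v] with y h1 h2
    rw [h1, Pi.smul_apply, h2, Pi.sub_apply, smul_eq_mul, abs_of_nonneg (le_max_right _ _)]
    refine max_le ?_ (abs_nonneg _)
    have := neg_abs_le (β * (u y - v y))
    linarith)
  refine h.trans ?_
  rw [norm_smul, Real.norm_of_nonneg hβ]
  have := norm_sub_le u v
  gcongr

/-! ### Equations and estimates on a single interval -/

namespace IsSemidiscreteSolution

/-- The test pair is $v$ on $I_m$ in the first slot and 0 in the second; the common factor $\tau_m$
cancels. -/
lemma elliptic (h : IsSemidiscreteSolution α β δ r P l d₀ φ d) {m : ℕ} (hm : m ∈ Icc 1 P.M)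
    (v : H10 Ω) :
    α * ⟪weakGrad (φ (P.node m)), weakGrad v⟫_ℝ + β * ⟪toL2 (φ (P.node m)), toL2 v⟫_ℝ
      - β * ⟪d (P.node m), toL2 v⟫_ℝ = ⟪timeMean P l m, toL2 v⟫_ℝ := by
  have hE := h.eqn (P.bump m v) 0 (P.bump_isPiecewiseConst hm v) P.zero_isPiecewiseConst
  have hz : ∀ t ∉ P.interval m, P.bump m v t = 0 := fun t ht => P.bump_of_notMem v ht
  have hv : ∀ t ∈ P.interval m, P.bump m v t = v := fun t ht => P.bump_of_mem v ht
  simp only [semidiscreteForm, TimePartition.plus, Pi.zero_apply, inner_zero_right,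
    integral_zero, Finset.sum_const_zero, add_zero] at hE
  have hmax : ∫ t in Ioo 0 T, ∫ x in Ω, max (-β * (d t x - toL2 (φ t) x) - r) 0
      * (0 : L2 Ω) x = 0 := by
    -- The representative of $0\in L^2(\Omega)$ is known to vanish only almost everywhere.
    have h0 : ∀ t, ∫ x in Ω, max (-β * (d t x - toL2 (φ t) x) - r) 0 * (0 : L2 Ω) x = 0 := by
      intro t
      refine integral_eq_zero_of_ae ((Lp.coeFn_zero ℝ 2 (volume.restrict Ω)).mono fun x hx => ?_)
      simp only [hx, Pi.zero_apply, mul_zero]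
    simp only [h0, integral_zero]
  rw [hmax, mul_zero, add_zero] at hE
  rw [P.setIntegral_eq_interval hm (fun t ht => by rw [hz t ht, weakGrad_zero, inner_zero_right]),
    P.setIntegral_eq_interval hm (fun t ht => by rw [hz t ht, toL2_zero, inner_zero_right]),
    P.setIntegral_eq_interval hm (fun t ht => by rw [hz t ht, toL2_zero, inner_zero_right]),
    P.setIntegral_eq_interval hm (fun t ht => by rw [hz t ht, toL2_zero, inner_zero_right]),
    P.setIntegral_interval_const hm (fun t ht => by rw [hv t ht, h.mem_V m hm t ht]),
    P.setIntegral_interval_const hm (fun t ht => by rw [hv t ht, h.mem_V m hm t ht]),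
    P.setIntegral_interval_const hm (fun t ht => by rw [hv t ht, h.mem_X m hm t ht]),
    TimePartition.interval,
    setIntegral_congr_fun measurableSet_Ioc (fun t ht => by rw [hv t ht])] at hE
  have hl := integral_inner_eq_timeMean l hm (toL2 v)
  rw [TimePartition.interval] at hl
  rw [hl] at hE
  refine mul_left_cancel₀ (P.step_pos hm).ne' ?_
  linarith

/-- The test pair is 0 and $x$ on $I_m$. The derivative term vanishes as $d$ is constant on each
interval, and only the jump at $t_{m-1}$ is seen. -/
lemma inner_jump (h : IsSemidiscreteSolution α β δ r P l d₀ φ d) {m : ℕ} (hm : m ∈ Icc 1 P.M)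
    (x : L2 Ω) :
    ⟪P.jumpFrom d₀ d (m - 1), x⟫_ℝ = 1 / δ * (P.step m * ∫ y in Ω,
      max (-β * (d (P.node m) y - toL2 (φ (P.node m)) y) - r) 0 * x y) := by
  have hE := h.eqn 0 (P.bump m x) P.zero_isPiecewiseConst (P.bump_isPiecewiseConst hm x)
  simp only [semidiscreteForm, Pi.zero_apply, toL2_zero, weakGrad_zero, inner_zero_right,
    integral_zero, mul_zero, add_zero, sub_zero, zero_add] at hE
  have hderiv : ∑ j ∈ Finset.Icc 1 P.M,
      ∫ t in Ioo (P.node (j - 1)) (P.node j), ⟪deriv d t, P.bump m x t⟫_ℝ = 0 := by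
    refine Finset.sum_eq_zero fun j hj => ?_
    refine setIntegral_eq_zero_of_forall_eq_zero fun t ht => ?_
    rw [h.mem_X.deriv_eq_zero P (by simpa using hj) ht, inner_zero_left]
  have hrhs : ∫ t in Ioo 0 T, ∫ y in Ω,
      max (-β * (d t y - toL2 (φ t) y) - r) 0 * P.bump m x t y
      = P.step m * ∫ y in Ω,
        max (-β * (d (P.node m) y - toL2 (φ (P.node m)) y) - r) 0 * x y := by
    rw [P.setIntegral_eq_interval hm, P.setIntegral_interval_const hm]
    · intro t ht
      rw [P.bump_of_mem x ht, h.mem_X m hm t ht, h.mem_V m hm t ht]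
    · intro t ht
      rw [P.bump_of_notMem x ht]
      refine integral_eq_zero_of_ae ((Lp.coeFn_zero ℝ 2 (volume.restrict Ω)).mono fun y hy => ?_)
      simp only [hy, Pi.zero_apply, mul_zero]
  rw [hderiv, hrhs, zero_add] at hE
  have h1M : 1 ∈ Icc 1 P.M := ⟨le_rfl, hm.1.trans hm.2⟩
  have hsum : ∑ j ∈ Finset.Icc 2 P.M, ⟪P.jump d (j - 1), P.plus (P.bump m x) (j - 1)⟫_ℝ
      = if 2 ≤ m then ⟪P.jump d (m - 1), x⟫_ℝ else 0 := by
    have hc : ∀ j ∈ Finset.Icc 2 P.M, ⟪P.jump d (j - 1), P.plus (P.bump m x) (j - 1)⟫_ℝ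
        = if j = m then ⟪P.jump d (m - 1), x⟫_ℝ else 0 := by
      intro j hj
      have hj' := Finset.mem_Icc.1 hj
      rw [TimePartition.plus, Nat.sub_add_cancel (by omega), P.bump_node hm ⟨by omega, hj'.2⟩]
      split_ifs with hjm
      · rw [hjm]
      · exact inner_zero_right _
    rw [Finset.sum_congr rfl hc, Finset.sum_ite_eq']
    simp [hm.2]
  have hplus : P.plus (P.bump m x) 0 = if 1 = m then x else 0 := P.bump_node hm h1M x
  rw [hsum, hplus] at hE
  -- For $m=1$ the jump sum vanishes and the two initial terms form $d_1-d_0$; for $m\ge2$ it is the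
  -- initial terms that vanish.
  rcases hm.1.eq_or_lt with rfl | h2
  · simp only [Nat.not_ofNat_le_one, if_false, if_true, zero_add] at hE
    rw [TimePartition.jumpFrom, if_pos rfl, inner_sub_left]
    linarith
  · rw [if_pos (by omega), if_neg h2.ne, inner_zero_right, inner_zero_right, add_zero,
      add_zero] at hE
    rw [TimePartition.jumpFrom, if_neg (by omega), hE]

/-- Energy test with $v=\varphi_m$: the gradient term is dropped and one factor $\|\varphi_m\|$
divided out. -/
lemma norm_toL2_le (h : IsSemidiscreteSolution α β δ r P l d₀ φ d) (hα : 0 < α) (hβ : 0 < β)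
    {m : ℕ} (hm : m ∈ Icc 1 P.M) :
    β * ‖toL2 (φ (P.node m))‖ ≤ β * ‖d (P.node m)‖ + ‖timeMean P l m‖ := by
  have hE := h.elliptic hm (φ (P.node m))
  rw [real_inner_self_eq_norm_sq, real_inner_self_eq_norm_sq] at hE
  have h1 := real_inner_le_norm (d (P.node m)) (toL2 (φ (P.node m)))
  have h2 := real_inner_le_norm (timeMean P l m) (toL2 (φ (P.node m)))
  have h3 : 0 ≤ α * ‖weakGrad (φ (P.node m))‖ ^ 2 := by positivity
  have h4 := mul_le_mul_of_nonneg_left h1 hβ.le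
  rcases (norm_nonneg (toL2 (φ (P.node m)))).eq_or_lt with h0 | h0
  · rw [← h0, mul_zero]
    positivity
  · refine le_of_mul_le_mul_right ?_ h0
    nlinarith

/-- Same energy test, now keeping the gradient term. The extra factor $\beta$ allows `norm_toL2_le`
to be inserted without division. -/
lemma norm_weakGrad_sq_le (h : IsSemidiscreteSolution α β δ r P l d₀ φ d) (hα : 0 < α)
    (hβ : 0 < β) {m : ℕ} (hm : m ∈ Icc 1 P.M) :
    α * β * ‖weakGrad (φ (P.node m))‖ ^ 2 ≤ (β * ‖d (P.node m)‖ + ‖timeMean P l m‖) ^ 2 := by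
  have hE := h.elliptic hm (φ (P.node m))
  rw [real_inner_self_eq_norm_sq, real_inner_self_eq_norm_sq] at hE
  have h1 := real_inner_le_norm (d (P.node m)) (toL2 (φ (P.node m)))
  have h2 := real_inner_le_norm (timeMean P l m) (toL2 (φ (P.node m)))
  have h3 : 0 ≤ β * ‖toL2 (φ (P.node m))‖ ^ 2 := by positivity
  have h4 := mul_le_mul_of_nonneg_left h1 hβ.le
  have h5 := h.norm_toL2_le hα hβ hm
  have h6 : α * ‖weakGrad (φ (P.node m))‖ ^ 2
      ≤ (β * ‖d (P.node m)‖ + ‖timeMean P l m‖) * ‖toL2 (φ (P.node m))‖ := by linarith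
  calc α * β * ‖weakGrad (φ (P.node m))‖ ^ 2 = β * (α * ‖weakGrad (φ (P.node m))‖ ^ 2) := by ring
    _ ≤ β * ((β * ‖d (P.node m)‖ + ‖timeMean P l m‖) * ‖toL2 (φ (P.node m))‖) := by gcongr
    _ = (β * ‖d (P.node m)‖ + ‖timeMean P l m‖) * (β * ‖toL2 (φ (P.node m))‖) := by ring
    _ ≤ (β * ‖d (P.node m)‖ + ‖timeMean P l m‖) * (β * ‖d (P.node m)‖ + ‖timeMean P l m‖) := by
        gcongr
    _ = _ := by ring

lemma norm_jump_le (h : IsSemidiscreteSolution α β δ r P l d₀ φ d) (hα : 0 < α) (hβ : 0 < β)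
    (hδ : 0 < δ) (hr : 0 < r) {m : ℕ} (hm : m ∈ Icc 1 P.M) :
    ‖P.jumpFrom d₀ d (m - 1)‖
      ≤ P.step m * ((2 * β + 1) / δ * (‖d (P.node m)‖ + ‖timeMean P l m‖)) := by
  set J := P.jumpFrom d₀ d (m - 1)
  have hJ := h.inner_jump hm J
  have hs := P.step_pos hm
  have hφ := h.norm_toL2_le hα hβ hm
  have hb := norm_nonneg (timeMean P l m)
  rcases (norm_nonneg J).eq_or_lt with h0 | h0
  · rw [← h0]
    positivity
  refine le_of_mul_le_mul_right ?_ h0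
  calc ‖J‖ * ‖J‖ = ⟪J, J⟫_ℝ := (real_inner_self_eq_norm_mul_norm J).symm
    _ ≤ 1 / δ * (P.step m * (β * (‖d (P.node m)‖ + ‖toL2 (φ (P.node m))‖) * ‖J‖)) := by
        rw [hJ]
        have := integral_max_mul_le hβ.le hr.le (d (P.node m)) (toL2 (φ (P.node m))) J
        gcongr
    _ ≤ 1 / δ * (P.step m * ((2 * β + 1) * (‖d (P.node m)‖ + ‖timeMean P l m‖) * ‖J‖)) := by
        -- By `norm_toL2_le` the left side is at most $2\beta\|d_m\|+\|l_m\|$.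
        have : β * (‖d (P.node m)‖ + ‖toL2 (φ (P.node m))‖)
            ≤ (2 * β + 1) * (‖d (P.node m)‖ + ‖timeMean P l m‖) := by
          have := norm_nonneg (d (P.node m))
          nlinarith
        gcongr
    _ = _ := by ring

/-- The value of the weak Laplacian of `φ_τ` on `I_m`. -/
noncomputable def laplacian (α β : ℝ) (P : TimePartition T) (l : L2L2 T Ω) (φ : ℝ → H10 Ω)
    (d : ℝ → L2 Ω) (m : ℕ) : L2 Ω :=
  α⁻¹ • (β • toL2 (φ (P.node m)) - β • d (P.node m) - timeMean P l m)

lemma hasWeakLaplacian (h : IsSemidiscreteSolution α β δ r P l d₀ φ d) (hα : 0 < α) {m : ℕ}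
    (hm : m ∈ Icc 1 P.M) :
    HasWeakLaplacian (φ (P.node m)) (laplacian α β P l φ d m) := by
  refine hasWeakLaplacian_of_inner_eq fun w => ?_
  have hE := h.elliptic hm w
  rw [laplacian, real_inner_smul_left, inner_sub_left, inner_sub_left, real_inner_smul_left,
    real_inner_smul_left, ← hE]
  field_simp
  ring

lemma norm_laplacian_le (h : IsSemidiscreteSolution α β δ r P l d₀ φ d) (hα : 0 < α) (hβ : 0 < β)
    {m : ℕ} (hm : m ∈ Icc 1 P.M) :
    α * ‖laplacian α β P l φ d m‖ ≤ 2 * (β * ‖d (P.node m)‖ + ‖timeMean P l m‖) := by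
  rw [laplacian, norm_smul, norm_inv, Real.norm_of_nonneg hα.le, mul_inv_cancel_left₀ hα.ne']
  have h1 := norm_sub_le (β • toL2 (φ (P.node m)) - β • d (P.node m)) (timeMean P l m)
  have h2 := norm_sub_le (β • toL2 (φ (P.node m))) (β • d (P.node m))
  rw [norm_smul, norm_smul, Real.norm_of_nonneg hβ.le] at h2
  linarith [h.norm_toL2_le hα hβ hm]

/-- Gronwall is applied to the norms, not their squares; squaring comes afterwards. -/
lemma norm_sq_le (h : IsSemidiscreteSolution α β δ r P l d₀ φ d) (hT : 0 < T) (hα : 0 < α)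
    (hβ : 0 < β) (hδ : 0 < δ) (hr : 0 < r) {K : ℝ} (hKdef : K = (2 * β + 1) / δ)
    (hmesh : P.mesh ≤ 1 / (2 * K)) {m : ℕ} (hm : m ∈ Icc 1 P.M) :
    ‖d (P.node m)‖ ^ 2
      ≤ 2 * Real.exp (2 * K * T) ^ 2 * (‖d₀‖ ^ 2 + K ^ 2 * (T * ‖l‖ ^ 2)) := by
  have hK : 0 < K := by rw [hKdef]; positivity
  have hg := P.gronwall hK.le (a := fun m => ‖P.state d₀ d m‖)
    (b := fun m => ‖timeMean P l m‖) (fun m hm => ?_) (fun _ => norm_nonneg _)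
    (fun _ => norm_nonneg _) (fun m hm => ?_) hm.2
  · simp only [P.state_of_mem d₀ d hm] at hg
    set S := ∑ j ∈ Finset.Icc 1 m, P.step j * ‖timeMean P l j‖
    have hsub : Finset.Icc 1 m ⊆ Finset.Icc 1 P.M := Finset.Icc_subset_Icc le_rfl hm.2
    have hpos : ∀ j ∈ Finset.Icc 1 P.M, 0 < P.step j := fun j hj => P.step_pos (by simpa using hj)
    have hS0 : 0 ≤ S := Finset.sum_nonneg fun j hj =>
      mul_nonneg (hpos j (hsub hj)).le (norm_nonneg _)
    have hS : S ^ 2 ≤ T * ‖l‖ ^ 2 := by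
      -- Weighted Cauchy–Schwarz, splitting $\tau_j\|l_j\|=\sqrt{\tau_j}\cdot\sqrt{\tau_j}\|l_j\|$;
      -- the weights sum to at most $T$.
      have hcs := Finset.sum_sq_le_sum_mul_sum_of_sq_le_mul (Finset.Icc 1 m)
        (r := fun j => P.step j * ‖timeMean P l j‖) (f := fun j => P.step j)
        (g := fun j => P.step j * ‖timeMean P l j‖ ^ 2) (fun j hj => (hpos j (hsub hj)).le)
        (fun j hj => mul_nonneg (hpos j (hsub hj)).le (sq_nonneg _)) (fun j _ => le_of_eq (by ring))
      refine hcs.trans (mul_le_mul ?_ ?_ ?_ hT.le)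
      · refine (Finset.sum_le_sum_of_subset_of_nonneg hsub fun j hj _ => (hpos j hj).le).trans ?_
        exact P.sum_step.le
      · refine (Finset.sum_le_sum_of_subset_of_nonneg hsub fun j hj _ =>
          mul_nonneg (hpos j hj).le (sq_nonneg _)).trans ?_
        exact sum_step_mul_norm_timeMean_sq_le P l
      · exact Finset.sum_nonneg fun j hj => mul_nonneg (hpos j (hsub hj)).le (sq_nonneg _)
    have hd0 : P.state d₀ d 0 = d₀ := if_pos rfl
    rw [hd0] at hg
    have hexp : Real.exp (2 * K * P.node m) ≤ Real.exp (2 * K * T) :=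
      Real.exp_le_exp.2 (mul_le_mul_of_nonneg_left (P.node_le hm.2) (by positivity))
    calc ‖d (P.node m)‖ ^ 2 ≤ (Real.exp (2 * K * T) * (‖d₀‖ + K * S)) ^ 2 := by
          refine pow_le_pow_left₀ (norm_nonneg _) (hg.trans ?_) 2
          gcongr
      _ = Real.exp (2 * K * T) ^ 2 * (‖d₀‖ + K * S) ^ 2 := by ring
      _ ≤ Real.exp (2 * K * T) ^ 2 * (2 * (‖d₀‖ ^ 2 + K ^ 2 * S ^ 2)) := by
          gcongr
          nlinarith [sq_nonneg (‖d₀‖ - K * S)]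
      _ ≤ Real.exp (2 * K * T) ^ 2 * (2 * (‖d₀‖ ^ 2 + K ^ 2 * (T * ‖l‖ ^ 2))) := by gcongr
      _ = _ := by ring
  · calc K * P.step m ≤ K * (1 / (2 * K)) :=
          mul_le_mul_of_nonneg_left ((P.step_le_mesh hm).trans hmesh) hK.le
      _ = 1 / 2 := by field_simp
  · have hj := h.norm_jump_le hα hβ hδ hr hm
    rw [P.jumpFrom_pred d₀ d hm.1, ← hKdef] at hj
    have ht := norm_add_le (P.state d₀ d (m - 1)) (P.state d₀ d m - P.state d₀ d (m - 1))
    rw [add_sub_cancel] at ht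
    rw [← P.state_of_mem d₀ d hm] at hj
    linarith

lemma local_bound (h : IsSemidiscreteSolution α β δ r P l d₀ φ d) (hα : 0 < α) (hβ : 0 < β)
    (hδ : 0 < δ) (hr : 0 < r) {K : ℝ} (hKdef : K = (2 * β + 1) / δ) {m : ℕ}
    (hm : m ∈ Icc 1 P.M) :
    P.step m * ‖laplacian α β P l φ d m‖ ^ 2 + P.step m * ‖weakGrad (φ (P.node m))‖ ^ 2
      + P.step m * ‖toL2 (φ (P.node m))‖ ^ 2 + P.step m * ‖d (P.node m)‖ ^ 2
      + (P.step m)⁻¹ * ‖P.jumpFrom d₀ d (m - 1)‖ ^ 2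
    ≤ ((8 / α ^ 2 + 2 / (α * β) + 2 / β ^ 2) * (β ^ 2 + 1) + 1 + 2 * K ^ 2)
      * (P.step m * (‖d (P.node m)‖ ^ 2 + ‖timeMean P l m‖ ^ 2)) := by
  have hs := P.step_pos hm
  have h1 := h.norm_laplacian_le hα hβ hm
  have h2 := h.norm_weakGrad_sq_le hα hβ hm
  have h3 := h.norm_toL2_le hα hβ hm
  have h4 := h.norm_jump_le hα hβ hδ hr hm
  rw [← hKdef] at h4
  have ha := norm_nonneg (d (P.node m))
  have hb := norm_nonneg (timeMean P l m)
  set a := ‖d (P.node m)‖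
  set b := ‖timeMean P l m‖
  have hq : (β * a + b) ^ 2 ≤ 2 * ((β ^ 2 + 1) * (a ^ 2 + b ^ 2)) := by
    nlinarith [sq_nonneg (β * a - b), sq_nonneg (β * b), sq_nonneg a]
  -- The 8 is $2^2$ from squaring the factor in `norm_laplacian_le`, times the 2 of `hq`.
  have e1 : ‖laplacian α β P l φ d m‖ ^ 2 ≤ 8 / α ^ 2 * ((β ^ 2 + 1) * (a ^ 2 + b ^ 2)) := by
    rw [div_mul_eq_mul_div, le_div_iff₀ (by positivity)]
    have := pow_le_pow_left₀ (by positivity) h1 2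
    linarith
  have e2 : ‖weakGrad (φ (P.node m))‖ ^ 2
      ≤ 2 / (α * β) * ((β ^ 2 + 1) * (a ^ 2 + b ^ 2)) := by
    rw [div_mul_eq_mul_div, le_div_iff₀ (by positivity)]
    linarith
  have e3 : ‖toL2 (φ (P.node m))‖ ^ 2 ≤ 2 / β ^ 2 * ((β ^ 2 + 1) * (a ^ 2 + b ^ 2)) := by
    rw [div_mul_eq_mul_div, le_div_iff₀ (by positivity)]
    have := pow_le_pow_left₀ (by positivity) h3 2
    linarith
  have e4 : (P.step m)⁻¹ * ‖P.jumpFrom d₀ d (m - 1)‖ ^ 2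
      ≤ P.step m * (2 * K ^ 2 * (a ^ 2 + b ^ 2)) := by
    rw [inv_mul_le_iff₀ hs]
    calc ‖P.jumpFrom d₀ d (m - 1)‖ ^ 2 ≤ (P.step m * (K * (a + b))) ^ 2 :=
          pow_le_pow_left₀ (norm_nonneg _) h4 2
      _ = P.step m * (P.step m * (K ^ 2 * (a + b) ^ 2)) := by ring
      _ ≤ P.step m * (P.step m * (K ^ 2 * (2 * (a ^ 2 + b ^ 2)))) := by
          gcongr
          exact add_sq_le
      _ = _ := by ring
  have e5 : a ^ 2 ≤ a ^ 2 + b ^ 2 := by linarith [sq_nonneg b]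
  have m1 := mul_le_mul_of_nonneg_left e1 hs.le
  have m2 := mul_le_mul_of_nonneg_left e2 hs.le
  have m3 := mul_le_mul_of_nonneg_left e3 hs.le
  have m5 := mul_le_mul_of_nonneg_left e5 hs.le
  linarith

end IsSemidiscreteSolution

end SemidiscreteDamage

/-! ### Summation over the intervals -/

theorem mainTheorem10 (N : ℕ) (hN : N = 2 ∨ N = 3)
    (Ω : Set (SemidiscreteDamage.Space N)) (hΩ : SemidiscreteDamage.IsConvexPolygonalDomain Ω)
    (T α β δ r : ℝ) (hT : 0 < T) (hα : 0 < α) (hβ : 0 < β) (hδ : 0 < δ) (hr : 0 < r) :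
    ∃ C : ℝ, 0 < C ∧ ∃ τ₀ : ℝ, 0 < τ₀ ∧ ∀ P : SemidiscreteDamage.TimePartition T, P.mesh ≤ τ₀ →
      ∀ (l : SemidiscreteDamage.L2L2 T Ω) (d₀ : SemidiscreteDamage.L2 Ω)
        (φ : ℝ → SemidiscreteDamage.H10 Ω) (d : ℝ → SemidiscreteDamage.L2 Ω),
        SemidiscreteDamage.IsSemidiscreteSolution α β δ r P l d₀ φ d →
        ∃ Δφ : ℝ → SemidiscreteDamage.L2 Ω, P.IsPiecewiseConst Δφ ∧
          (∀ t ∈ Set.Ioc 0 T, SemidiscreteDamage.HasWeakLaplacian (φ t) (Δφ t)) ∧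
          SemidiscreteDamage.normSqTime T Δφ
            + SemidiscreteDamage.normSqTime T (fun t => SemidiscreteDamage.weakGrad (φ t))
            + SemidiscreteDamage.normSqTime T (fun t => SemidiscreteDamage.toL2 (φ t))
            + SemidiscreteDamage.normSqTime T d
            + ∑ m ∈ Finset.Icc 1 P.M, (P.step m)⁻¹ * ‖P.jumpFrom d₀ d (m - 1)‖ ^ 2
            ≤ C * (‖d₀‖ ^ 2 + ‖l‖ ^ 2) := by
  open SemidiscreteDamage IsSemidiscreteSolution in
  set K := (2 * β + 1) / δ with hKdef
  have hK : 0 < K := by positivity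
  -- `A` is the constant of `local_bound`, and `B` is $T$ times the prefactor in `norm_sq_le`. In
  -- the constant $C$ below, the added 1 accounts for $\sum_m\tau_m\|l_m\|^2\le\|l\|^2$.
  set A := (8 / α ^ 2 + 2 / (α * β) + 2 / β ^ 2) * (β ^ 2 + 1) + 1 + 2 * K ^ 2
  set B := T * (2 * Real.exp (2 * K * T) ^ 2)
  have hA : 0 < A := by positivity
  have hB : 0 < B := by positivity
  refine ⟨A * (B * (1 + K ^ 2 * T) + 1), by positivity, 1 / (2 * K), by positivity, ?_⟩
  intro P hmesh l d₀ φ d h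
  refine ⟨P.stepFun (laplacian α β P l φ d), P.stepFun_isPiecewiseConst _, fun t ht => ?_, ?_⟩
  · obtain ⟨m, hm, htm⟩ := P.exists_mem_interval ht
    rw [P.stepFun_of_mem _ hm htm, h.mem_V m hm t htm]
    exact h.hasWeakLaplacian hα hm
  rw [(P.stepFun_isPiecewiseConst _).normSqTime P, h.mem_X.normSqTime P,
    TimePartition.IsPiecewiseConst.normSqTime P (v := fun t => weakGrad (φ t))
      fun m hm t ht => by simp only [h.mem_V m hm t ht],
    TimePartition.IsPiecewiseConst.normSqTime P (v := fun t => toL2 (φ t))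
      fun m hm t ht => by simp only [h.mem_V m hm t ht],
    ← Finset.sum_add_distrib, ← Finset.sum_add_distrib, ← Finset.sum_add_distrib,
    ← Finset.sum_add_distrib]
  set D := 2 * Real.exp (2 * K * T) ^ 2 * (‖d₀‖ ^ 2 + K ^ 2 * (T * ‖l‖ ^ 2)) with hD
  have hd : ∑ m ∈ Finset.Icc 1 P.M, P.step m * ‖d (P.node m)‖ ^ 2 ≤ T * D := by
    refine le_of_le_of_eq ?_ (congrArg (· * D) P.sum_step)
    simp only [Finset.sum_mul]
    refine Finset.sum_le_sum fun m hm => ?_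
    have hm' : m ∈ Set.Icc 1 P.M := by simpa using hm
    exact mul_le_mul_of_nonneg_left (h.norm_sq_le hT hα hβ hδ hr hKdef hmesh hm')
      (P.step_pos hm').le
  calc _ ≤ ∑ m ∈ Finset.Icc 1 P.M,
        A * (P.step m * (‖d (P.node m)‖ ^ 2 + ‖timeMean P l m‖ ^ 2)) := by
        refine Finset.sum_le_sum fun m hm => ?_
        have hm' : m ∈ Set.Icc 1 P.M := by simpa using hm
        rw [P.stepFun_of_mem _ hm' (P.node_mem_interval hm')]
        exact h.local_bound hα hβ hδ hr hKdef hm'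
    _ = A * (∑ m ∈ Finset.Icc 1 P.M, P.step m * ‖d (P.node m)‖ ^ 2
        + ∑ m ∈ Finset.Icc 1 P.M, P.step m * ‖timeMean P l m‖ ^ 2) := by
        rw [← Finset.mul_sum, ← Finset.sum_add_distrib]
        simp only [mul_add]
    _ ≤ A * (T * D + ‖l‖ ^ 2) := by
        have := sum_step_mul_norm_timeMean_sq_le P l
        gcongr
    _ = A * (B * (‖d₀‖ ^ 2 + K ^ 2 * T * ‖l‖ ^ 2) + ‖l‖ ^ 2) := by
        rw [hD]
        ring
    _ ≤ A * ((B * (1 + K ^ 2 * T) + 1) * (‖d₀‖ ^ 2 + ‖l‖ ^ 2)) := by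
        refine mul_le_mul_of_nonneg_left ?_ hA.le
        -- This is exactly the difference of the two sides, without the factor `A`.
        have : 0 ≤ B * (K ^ 2 * T * ‖d₀‖ ^ 2) + B * ‖l‖ ^ 2 + ‖d₀‖ ^ 2 := by positivity
        linarith
    _ = _ := by ring
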